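/- Let $\Phi$ be a finite irreducible reduced crystallographic root system in the real vector space $E=\operatorname{span}_{\mathbb R}\Phi$, with Weyl group $W$. Fix a root basis $\Pi=\{\alpha_1,\dots,\alpha_n\}$ of $\Phi$, let $\breve\omega_1,\dots,\breve\omega_n$ be the fundamental coweights (the dual basis of $\Pi$), and write the highest root as $\theta=\sum_{i=1}^n m_i\alpha_i$. Let $\mathcal P_\Phi$ be the root polytope, i.e. the convex hull of $\Phi$, and for $I\subseteq\{1,\dots,n\}$ put $$F_I=\{x\in\mathcal P_\Phi\mid (x,\breve\omega_i)=m_i\ \text{ for all } i\in I\},$$ so that $F_\emptyset=\mathcal P_\Phi$; the sets $F_I$ are called the standard parabolic faces. A proper face of $\mathcal P_\Phi$ is the intersection of $\mathcal P_\Phi$ with an affine hyperplane such that $\mathcal P_\Phi$ lies in one of the two closed half-spaces it bounds; the faces of $\mathcal P_\Phi$ are the proper faces and $\mathcal P_\Phi$ itself. Theorem 5.4. Every nonempty face $F$ of the root polytope $\mathcal P_\Phi$ is parabolic: there exist $w\in W$ and $I\subseteq\{1,\dots,n\}$ such that $w(F)=F_I$. Moreover, if $F\neq\mathcal P_\Phi$,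 then $I\neq\emptyset$. -/

import Mathlib

open Module

namespace RootPolytope

section General

variable {ι M N : Type*} [AddCommGroup M] [Module ℝ M] [AddCommGroup N] [Module ℝ N]

/-- `θ` is the highest root with respect to the root basis `b`: every `θ - β`, with `β` a root, is
a sum of simple roots. -/
def IsHighestRoot {P : RootPairing ι ℝ M N} (b : P.Base) (t : ι) : Prop :=
  ∀ j, P.root t - P.root j ∈ AddSubmonoid.closure (P.root '' b.support)

/-- Every irreducible root system has a highest root. -/
theorem exists_isHighestRoot [Finite ι] {P : RootPairing ι ℝ M N} [P.IsRootSystem]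
    [P.IsCrystallographic] [P.IsReduced] [P.IsIrreducible] (b : P.Base) :
    ∃ t, IsHighestRoot b t := by
  classical
  have : Nontrivial M := RootPairing.IsIrreducible.nontrivial P
  have hne : Nonempty ι := by
    by_contra h
    rw [not_nonempty_iff] at h
    have h1 := RootPairing.IsRootSystem.span_root_eq_top (P := P)
    rw [Set.range_eq_empty, Submodule.span_empty] at h1
    exact bot_ne_top h1
  obtain ⟨t, ht⟩ := Finite.exists_max b.height
  have hrefl : ∀ i, b.height (P.reflectionPerm i i) = -b.height i :=
    fun i ↦ b.height_reflectionPerm_self i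
  have hsupp : ∀ i ∈ b.support, P.root i ∈ AddSubmonoid.closure (P.root '' b.support) :=
    fun i hi ↦ AddSubmonoid.subset_closure ⟨i, hi, rfl⟩
  obtain ⟨i₀, hi₀⟩ := b.support_nonempty
  have htpos : b.IsPos t := by
    have h1 := ht i₀
    rw [RootPairing.Base.height_one_of_mem_support hi₀] at h1
    rw [RootPairing.Base.isPos_iff]
    omega
  have hpos : ∀ {i}, b.IsPos i → P.root i ∈ AddSubmonoid.closure (P.root '' b.support) := by
    intro i hi
    refine hi.induction_on_add hsupp ?_
    intro i j k hk hi hj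
    rw [hk]
    exact add_mem hi (hsupp j hj)
  -- the highest element of the poset is dominant
  have hdom : ∀ i ∈ b.support, 0 ≤ P.pairingIn ℤ t i := by
    intro i hi
    by_contra! hlt
    obtain ⟨k, hk⟩ := P.root_add_root_mem_of_pairingIn_neg hlt (by
      intro h
      have : P.root t = P.root (P.reflectionPerm i i) := by simp [h]
      have := P.root.injective this
      have h1 := htpos
      rw [this, RootPairing.Base.isPos_iff, hrefl,
        RootPairing.Base.height_one_of_mem_support hi] at h1
      omega)
    have h1 := b.height_add hk
    rw [RootPairing.Base.height_one_of_mem_support hi] at h1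
    have h2 := ht k
    omega
  obtain ⟨f, hf₀, hf₁, hf₂⟩ := b.exists_root_eq_sum_int t
  replace hf₁ : 0 < f := by
    refine hf₁.resolve_right fun h ↦ ?_
    have h1 := htpos
    rw [RootPairing.Base.isPos_iff, RootPairing.Base.height_eq_sum hf₂] at h1
    exact absurd (Finset.sum_nonpos fun i _ ↦ h.le i) (not_le.mpr h1)
  have hpair : ∀ j, P.pairingIn ℤ t j = ∑ i ∈ b.support, f i * P.pairingIn ℤ i j := by
    intro j
    refine FaithfulSMul.algebraMap_injective ℤ ℝ ?_
    simp_rw [map_sum, map_mul, RootPairing.algebraMap_pairingIn,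
      ← RootPairing.root_coroot_eq_pairing]
    rw [hf₂]
    simp
  -- all coordinates of the highest root are positive
  have hfull : ∀ j : b.support, 0 < f j := by
    obtain ⟨k, hk⟩ : ∃ k, 0 < f k := by
      by_contra! h
      exact hf₁.not_ge h
    have hkb : k ∈ b.support := hf₀ (by simpa using hk.ne')
    intro j
    refine b.induction_on_cartanMatrix (fun i ↦ 0 < f i) (i := ⟨k, hkb⟩) hk ?_
    intro i j hi hij
    by_contra! hj
    have hj0 : f j = 0 := le_antisymm hj (hf₁.le _)
    have hne : i ≠ j := by
      rintro rfl
      omega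
    have hlt : P.pairingIn ℤ i j < 0 := by
      rcases (b.pairingIn_le_zero_of_ne (fun h ↦ hne (Subtype.ext h)) i.2 j.2).lt_or_eq
        with h | h
      · exact h
      · exact absurd (P.pairingIn_eq_zero_iff.mp h) hij
    have h1 := hdom j j.2
    rw [hpair] at h1
    refine absurd h1 (not_le.mpr ?_)
    refine Finset.sum_neg' (fun l hl ↦ ?_) ⟨i, i.2, mul_neg_of_pos_of_neg hi hlt⟩
    by_cases hlj : l = j
    · simp [hlj, hj0]
    · exact mul_nonpos_of_nonneg_of_nonpos (hf₁.le _) (b.pairingIn_le_zero_of_ne hlj hl j.2)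
  refine ⟨t, fun j ↦ ?_⟩
  by_cases hj : b.IsPos j
  swap
  · have := (b.root_mem_or_neg_mem j)
    have hneg : -P.root j ∈ AddSubmonoid.closure (P.root '' b.support) := by
      have h1 := hpos ((RootPairing.Base.IsPos.neg_iff_not b j).mpr hj)
      simpa using h1
    rw [sub_eq_add_neg]
    exact add_mem (hpos htpos) hneg
  generalize hN : (b.height t - b.height j).toNat = n
  induction n using Nat.strongRecOn generalizing j with
  | ind n ih =>
    rcases eq_or_ne t j with rfl | htj
    · simp
    by_cases hex : ∃ i ∈ b.support, P.pairingIn ℤ j i < 0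
    · obtain ⟨i, hi, hlt⟩ := hex
      have hipos := RootPairing.Base.isPos_of_mem_support hi
      obtain ⟨k, hk⟩ := P.root_add_root_mem_of_pairingIn_neg hlt (by
        intro h
        have : P.root j = P.root (P.reflectionPerm i i) := by simp [h]
        have := P.root.injective this
        rw [this, RootPairing.Base.isPos_iff, hrefl,
          RootPairing.Base.height_one_of_mem_support hi] at hj
        omega)
      have h1 := b.height_add hk
      rw [RootPairing.Base.height_one_of_mem_support hi] at h1
      have h2 := ht k
      have h3 := ih _ (by omega) k (hj.add hipos hk) rfl
      have h4 : P.root t - P.root j = (P.root t - P.root k) + P.root i := by rw [hk]; abel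
      rw [h4]
      exact add_mem h3 (hsupp i hi)
    · push Not at hex
      obtain ⟨i, hi, hij⟩ := hj.exists_mem_support_pos_pairingIn
      have hlt : 0 < P.pairingIn ℤ t j := by
        rw [hpair]
        refine Finset.sum_pos' (fun l hl ↦ mul_nonneg (hf₁.le l) ?_)
          ⟨i, hi, mul_pos (hfull ⟨i, hi⟩) hij⟩
        have := hex l hl
        by_contra! h
        exact absurd ((P.pairingIn_lt_zero_iff ℤ).mp h) (not_lt.mpr this)
      obtain ⟨k, hk⟩ := P.root_sub_root_mem_of_pairingIn_pos hlt htj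
      rw [← hk]
      apply hpos
      rw [RootPairing.Base.isPos_iff', b.height_sub hk]
      have := ht j
      omega

/-- The root polytope: the convex hull of all the roots. -/
def rootPolytope (P : RootPairing ι ℝ M N) : Set M :=
  convexHull ℝ (Set.range P.root)

/-- A proper face of a convex set `A` is the intersection of `A` with an affine hyperplane
`{x | f x = c}` that does not split `A`, i.e. such that `A` lies on one side of it. -/
def IsProperFace (A F : Set M) : Prop :=
  ∃ f : Dual ℝ M, f ≠ 0 ∧ ∃ c : ℝ, (∀ x ∈ A, f x ≤ c) ∧ F = {x ∈ A | f x = c}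

/-- The faces of `A` are its proper faces and `A` itself. -/
def IsFace (A F : Set M) : Prop :=
  F = A ∨ IsProperFace A F

end General

noncomputable section

variable {ι M N : Type*} [AddCommGroup M] [Module ℝ M] [AddCommGroup N] [Module ℝ N]
  {P : RootPairing ι ℝ M N} [P.IsRootSystem]

/-- The fundamental coweights: the elements of the coweight space that form the dual basis of the
simple roots; `ω̌ i` is the element that pairs with every `x` to the `i`-th coordinate of `x` with
respect to the simple roots. -/
def fundamentalCoweight (b : P.Base) (i : b.support) : N :=
  P.flip.toPerfPair.symm (b.toWeightBasis.coord i)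

theorem apply_fundamentalCoweight (b : P.Base) (i : b.support) (x : M) :
    P.toLinearMap x (fundamentalCoweight b i) = b.toWeightBasis.repr x i := by
  have h : P.flip.toPerfPair (fundamentalCoweight b i) = b.toWeightBasis.coord i := by
    simp [fundamentalCoweight]
  have h2 := LinearMap.congr_fun h x
  simpa using h2

variable [Finite ι] [P.IsCrystallographic] [P.IsReduced] [P.IsIrreducible]

/-- The highest root `θ` with respect to the root basis `b`. -/
def highestRoot (b : P.Base) : M :=
  P.root (exists_isHighestRoot b).choose

/-- The coefficient `m i` of the simple root `α i` in the highest root. -/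
def highestRootCoeff (b : P.Base) (i : b.support) : ℝ :=
  b.toWeightBasis.repr (highestRoot b) i

/-- The standard parabolic face `F_I = {x ∈ P_Φ | (x, ω̌ i) = m i for all i ∈ I}`, where `I` is a
set of (indices of) simple roots. In particular, `F_∅` is the whole root polytope. -/
def standardParabolicFace (b : P.Base) (I : Set b.support) : Set M :=
  {x ∈ rootPolytope P | ∀ i ∈ I, P.toLinearMap x (fundamentalCoweight b i) = highestRootCoeff b i}

end

end RootPolytope

/-!
A nonempty proper face is `F = {x ∈ 𝒫 | f x = c}`, where `f` is a nonzero functional and `c` is its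
maximum on the root polytope `𝒫`. The Weyl group `W` is finite and preserves `𝒫`, so `f` may be
replaced by a translate `g = f ∘ w` that is nonnegative on all the simple roots
(`exists_weylGroup_forall_nonneg`): choose `v` strictly dominant and `w ∈ W` maximizing `f (w v)`;
comparing `w` with `w sᵢ` gives `f (w αᵢ) ≥ 0`.

On `𝒫` the `i`-th coordinate in the basis of simple roots is at most the coefficient `mᵢ` of the
highest root (`repr_le_highestRootCoeff`), since this is so for every root. So for `x ∈ 𝒫`
the sum `g θ - g x = ∑ᵢ (mᵢ - xᵢ) g αᵢ` has nonnegative terms. It follows that the maximum of `g` is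
`g θ`, and that it is attained exactly where `xᵢ = mᵢ` for all `i` with `g αᵢ ≠ 0`. Hence
`w⁻¹ F = F_I` with `I = {i | g αᵢ ≠ 0}`, which is nonempty because `g ≠ 0`.
-/

namespace RootPolytope

variable {ι M N : Type*} [AddCommGroup M] [Module ℝ M] [AddCommGroup N] [Module ℝ N]
  {P : RootPairing ι ℝ M N}

theorem finite_weylGroup [Finite ι] [P.IsRootSystem] : Finite P.weylGroup := by
  refine Finite.of_injective P.weylGroupToPerm fun g h hgh ↦ Subtype.ext ?_
  refine RootPairing.Equiv.weightHom_injective P (LinearEquiv.toLinearMap_injective ?_)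
  refine LinearMap.ext_on_range (v := P.root) RootPairing.IsRootSystem.span_root_eq_top fun i ↦ ?_
  change g • P.root i = h • P.root i
  rw [P.weylGroup_apply_root, P.weylGroup_apply_root, hgh]

/-- Every linear functional has a Weyl group translate in the closed dominant chamber. -/
theorem exists_weylGroup_forall_nonneg [Finite ι] [P.IsRootSystem] (b : P.Base) (f : Dual ℝ M) :
    ∃ w : P.weylGroup, ∀ i : b.support, 0 ≤ f (w • P.root i) := by
  have := finite_weylGroup (P := P)
  -- a vector pairing to `1` with every simple coroot is strictly dominant
  obtain ⟨v, hv⟩ : ∃ v : M, ∀ i : b.support, P.toLinearMap v (P.coroot i) = 1 := by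
    refine ⟨P.toPerfPair.symm (b.toCoweightBasis.constr ℝ fun _ ↦ (1 : ℝ)), fun i ↦ ?_⟩
    rw [← P.toPerfPair_apply, LinearEquiv.apply_symm_apply, ← b.toCoweightBasis_apply,
      Basis.constr_basis]
  obtain ⟨w, hw⟩ := Finite.exists_max fun w : P.weylGroup ↦ f (w • v)
  refine ⟨w, fun i ↦ ?_⟩
  have h := hw (w * RootPairing.weylGroup.ofIdx P i)
  have hs : RootPairing.weylGroup.ofIdx P i • v = v - P.root i := by
    rw [RootPairing.weylGroup.ofIdx_smul, RootPairing.Equiv.reflection_smul,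
      RootPairing.reflection_apply, RootPairing.coroot', LinearMap.flip_apply, hv, one_smul]
  rw [mul_smul, hs, smul_sub, map_sub] at h
  linarith

theorem smul_mem_rootPolytope (w : P.weylGroup) {x : M} (hx : x ∈ rootPolytope P) :
    w • x ∈ rootPolytope P := by
  have hsub : rootPolytope P ⊆ P.weylGroupRootRep w ⁻¹' rootPolytope P := by
    refine convexHull_min ?_ ((convex_convexHull ℝ _).linear_preimage _)
    rintro _ ⟨i, rfl⟩
    refine subset_convexHull ℝ _ ⟨P.weylGroupToPerm w i, ?_⟩
    exact (P.weylGroup_apply_root w i).symm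
  exact hsub hx

variable [Finite ι] [P.IsRootSystem] [P.IsCrystallographic] [P.IsReduced] [P.IsIrreducible]

theorem highestRoot_mem_rootPolytope (b : P.Base) : highestRoot b ∈ rootPolytope P :=
  subset_convexHull ℝ _ ⟨_, rfl⟩

theorem repr_le_highestRootCoeff (b : P.Base) (i : b.support) {x : M} (hx : x ∈ rootPolytope P) :
    b.toWeightBasis.repr x i ≤ highestRootCoeff b i := by
  have hsub : rootPolytope P ⊆ {x | b.toWeightBasis.coord i x ≤ highestRootCoeff b i} := by
    refine convexHull_min ?_ (convex_halfSpace_le (b.toWeightBasis.coord i).isLinear _)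
    rintro _ ⟨j, rfl⟩
    suffices ∀ y ∈ AddSubmonoid.closure (P.root '' b.support), 0 ≤ b.toWeightBasis.repr y i by
      have h := this _ ((exists_isHighestRoot b).choose_spec j)
      rw [map_sub, Finsupp.sub_apply, sub_nonneg] at h
      exact h
    intro y hy
    induction hy using AddSubmonoid.closure_induction with
    | mem y hy =>
      obtain ⟨k, hk, rfl⟩ := hy
      rw [b.toWeightBasis_repr_root ⟨k, hk⟩]
      exact Finsupp.single_nonneg.mpr zero_le_one i
    | zero => simp
    | add y z _ _ hy hz =>
      rw [map_add, Finsupp.add_apply]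
      exact add_nonneg hy hz
  exact hsub hx

theorem map_highestRoot_sub_eq_sum (b : P.Base) (g : Dual ℝ M) (x : M) :
    g (highestRoot b) - g x =
      ∑ i, (highestRootCoeff b i - b.toWeightBasis.repr x i) * g (P.root i) := by
  rw [← map_sub]
  conv_lhs => rw [← b.toWeightBasis.sum_repr (highestRoot b - x)]
  simp [highestRootCoeff]

/-- A functional that is nonnegative on the simple roots attains its maximum over the root polytope
at the highest root. -/
theorem le_map_highestRoot (b : P.Base) {g : Dual ℝ M} (hg : ∀ i : b.support, 0 ≤ g (P.root i))
    {x : M} (hx : x ∈ rootPolytope P) : g x ≤ g (highestRoot b) := by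
  rw [← sub_nonneg, map_highestRoot_sub_eq_sum]
  exact Finset.sum_nonneg fun i _ ↦
    mul_nonneg (sub_nonneg.mpr (repr_le_highestRootCoeff b i hx)) (hg i)

/-- The face on which a functional, nonnegative on the simple roots, is maximal is the standard
parabolic face of the simple roots at which the functional does not vanish. -/
theorem setOf_map_eq_map_highestRoot (b : P.Base) {g : Dual ℝ M}
    (hg : ∀ i : b.support, 0 ≤ g (P.root i)) :
    {x ∈ rootPolytope P | g x = g (highestRoot b)} =
      standardParabolicFace b {i | g (P.root i) ≠ 0} := by
  ext x
  refine and_congr_right fun hx ↦ ?_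
  rw [eq_comm, ← sub_eq_zero, map_highestRoot_sub_eq_sum, Finset.sum_eq_zero_iff_of_nonneg
    fun i _ ↦ mul_nonneg (sub_nonneg.mpr (repr_le_highestRootCoeff b i hx)) (hg i)]
  simp only [Finset.mem_univ, true_imp_iff, mul_eq_zero, sub_eq_zero, Set.mem_ofPred_eq,
    apply_fundamentalCoweight, or_iff_not_imp_right]
  exact forall_congr' fun i ↦ imp_congr_right fun _ ↦ eq_comm

end RootPolytope

open RootPolytope in
theorem theorem5p4 {ι M N : Type*} [Finite ι] [AddCommGroup M] [Module ℝ M]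
    [AddCommGroup N] [Module ℝ N] (P : RootPairing ι ℝ M N) [P.IsRootSystem]
    [P.IsCrystallographic] [P.IsReduced] [P.IsIrreducible] (b : P.Base) (F : Set M)
    (hF : RootPolytope.IsFace (RootPolytope.rootPolytope P) F) (hne : F.Nonempty) :
    ∃ w : P.weylGroup, ∃ I : Set b.support,
      (F ≠ RootPolytope.rootPolytope P → I.Nonempty) ∧
      (fun x : M ↦ w • x) '' F = RootPolytope.standardParabolicFace b I := by
  rcases hF with rfl | ⟨f, hf, c, hle, rfl⟩
  · exact ⟨1, ∅, fun h ↦ absurd rfl h, by simp [standardParabolicFace]⟩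
  obtain ⟨w, hw⟩ := exists_weylGroup_forall_nonneg b f
  let g : Dual ℝ M := f ∘ₗ P.weylGroupRootRep w
  have hgf (x : M) : g x = f (w • x) := rfl
  have hc : c = g (highestRoot b) := by
    refine le_antisymm ?_ (hle _ (smul_mem_rootPolytope w (highestRoot_mem_rootPolytope b)))
    obtain ⟨x, hx, rfl⟩ := hne
    have h := le_map_highestRoot b (g := g) hw (smul_mem_rootPolytope w⁻¹ hx)
    rwa [hgf, smul_inv_smul] at h
  refine ⟨w⁻¹, {i | g (P.root i) ≠ 0}, fun _ ↦ ?_, ?_⟩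
  · by_contra hI
    have hg0 : g = 0 := b.toWeightBasis.ext fun i ↦ by
      rw [b.toWeightBasis_apply]
      by_contra hi
      exact hI ⟨i, hi⟩
    refine hf (LinearMap.ext fun x ↦ ?_)
    have h := hgf (w⁻¹ • x)
    rwa [smul_inv_smul, hg0, eq_comm] at h
  · rw [← setOf_map_eq_map_highestRoot b (g := g) hw, ← hc]
    ext x
    constructor
    · rintro ⟨y, ⟨hy, hyc⟩, rfl⟩
      refine ⟨smul_mem_rootPolytope _ hy, ?_⟩
      change f (w • w⁻¹ • y) = c
      rwa [smul_inv_smul]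
    · rintro ⟨hx, hxc⟩
      exact ⟨w • x, ⟨smul_mem_rootPolytope w hx, hxc⟩, inv_smul_smul w x⟩
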